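/- Let $C>0$, $\alpha_1\ge 1$, $\alpha_2\ge 1$, $r\in[-1,0)$, and let $$F_{CD}(l_1,l_2)=C\,l_1^{\frac{\alpha_1}{\alpha_1+\alpha_2+1}}\,l_2^{\frac{\alpha_2}{\alpha_1+\alpha_2+1}},\qquad l_1,l_2\ge 0,$$ be the Cobb–Douglas production function. Write $\mathbb R^2_+=[0,\infty)^2$ and $p\circ x=(p_1x_1,p_2x_2)$. Call $f:\mathbb R^2_+\to\mathbb R$ neoclassical if it is positively homogeneous of degree one, concave and continuous on $\mathbb R^2_+$. Its unit cost function is $h(p)=\inf\{\tfrac{p\cdot v}{f(v)} : v\ge 0,\ f(v)>0\}$. Given a non-negative Borel measure $\mu$ on $\mathbb R^2_+$ (the distribution of capacities over technologies), the production function of the generalized Houthakker–Johansen model with data $(f,\mu)$ is the function which assigns to each $l=(l_1,l_2)\ge 0$ the maximal value of $$\int_{\mathbb R^2_+}\min\bigl(1,f(\tfrac{u_1(x)}{x_1},\tfrac{u_2(x)}{x_2})\bigr)\,\mu(dx)$$ over all $u=(u_1,u_2)\ge 0$ with $\mu$-integrable components for which this integral converges and $$\int_{\mathbb R^2_+}u_j(x)\,\mu(dx)\le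 l_j,\qquad j=1,2 .$$ Then there are neoclassical functions $f\ge 0$ whose unit cost is $$h(p\circ x)=\bigl(p_1^{-r}x_1^{-r}+p_2^{-r}x_2^{-r}\bigr)^{-\frac1r},\qquad p,x\in\mathbb R^2_+,$$ and for every neoclassical $f$ with this unit cost, $F_{CD}$ is the production function of the generalized Houthakker–Johansen model with data $(f,\mu)$, where $$\mu(dx)=A_r\,x_1^{\alpha_1-1}x_2^{\alpha_2-1}\,dx,\qquad A_r=(-r)\,A\,\frac{B(\alpha_1,\alpha_2)}{B(-\frac{\alpha_1}{r},-\frac{\alpha_2}{r})},$$ $$A=C^{\alpha_1+\alpha_2+1}\,\frac{(\alpha_1+\alpha_2)\,\alpha_1^{\alpha_1}\alpha_2^{\alpha_2}}{(\alpha_1+\alpha_2+1)^{\alpha_1+\alpha_2}}\,\frac1{B(\alpha_1,\alpha_2)},$$ and $B(\cdot,\cdot)$ is the beta function; in particular the maximum is attained for every $l\ge 0$. -/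

import Mathlib

open MeasureTheory

noncomputable section

/-- The closed non-negative orthant of `ℝⁿ`. -/
def orthant (n : ℕ) : Set (Fin n → ℝ) := {x | ∀ i, 0 ≤ x i}

/-- Neoclassical micro-level production function: positively homogeneous of degree one, concave
and continuous on the non-negative orthant (values off the orthant are irrelevant). -/
structure IsNeoclassical {n : ℕ} (f : (Fin n → ℝ) → ℝ) : Prop where
  homogeneous : ∀ c : ℝ, 0 < c → ∀ v ∈ orthant n, f (c • v) = c * f v
  concave : ConcaveOn ℝ (orthant n) f
  continuous : ContinuousOn f (orthant n)

/-- The Young transform `h(p) = inf {p · v / f(v) | v ≥ 0, f(v) > 0}`. For `p ≥ 0` the set is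
bounded below by `0`. -/
def youngTransform {n : ℕ} (f : (Fin n → ℝ) → ℝ) (p : Fin n → ℝ) : ℝ :=
  sInf {y | ∃ v ∈ orthant n, 0 < f v ∧ y = (∑ i, p i * v i) / f v}

/-- The production function `min(1, f(u₁/x₁, …, uₙ/xₙ))` of a unit capacity with technology `x`,
evaluated at the input vector `u`. -/
def unitOutput {n : ℕ} (f : (Fin n → ℝ) → ℝ) (x u : Fin n → ℝ) : ℝ :=
  min 1 (f fun i => u i / x i)

/-- Total output of the industry under the resource distribution `u`. -/
def totalOutput {n : ℕ} (f : (Fin n → ℝ) → ℝ) (μ : Measure (Fin n → ℝ))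
    (u : (Fin n → ℝ) → (Fin n → ℝ)) : ℝ :=
  ∫ x in orthant n, unitOutput f x (u x) ∂μ

/-- Admissible resource distributions for the inputs `l`: non-negative vector functions with
`μ`-integrable components, respecting the resource constraints, and for which the total output is
a convergent integral. -/
structure IsAdmissible {n : ℕ} (f : (Fin n → ℝ) → ℝ) (μ : Measure (Fin n → ℝ))
    (l : Fin n → ℝ) (u : (Fin n → ℝ) → (Fin n → ℝ)) : Prop where
  nonneg : ∀ x ∈ orthant n, ∀ j, 0 ≤ u x j
  integrable : ∀ j, IntegrableOn (fun x => u x j) (orthant n) μ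
  resource : ∀ j, ∫ x in orthant n, u x j ∂μ ≤ l j
  integrable_output : IntegrableOn (fun x => unitOutput f x (u x)) (orthant n) μ

/-- `F` is the production function of the generalized Houthakker–Johansen model with
micro-level production function `f` and distribution of capacities `μ`: for each `l ≥ 0`, the
value `F l` is the maximum of the total output over the admissible resource distributions. -/
def IsProductionFunction {n : ℕ} (f : (Fin n → ℝ) → ℝ) (μ : Measure (Fin n → ℝ))
    (F : (Fin n → ℝ) → ℝ) : Prop :=
  ∀ l ∈ orthant n, IsGreatest {y | ∃ u, IsAdmissible f μ l u ∧ y = totalOutput f μ u} (F l)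

/-- The unit cost `h(p ∘ x)` of `f` is `(p₁^{-r} x₁^{-r} + p₂^{-r} x₂^{-r})^{-1/r}`. -/
def HasCESUnitCost (r : ℝ) (f : (Fin 2 → ℝ) → ℝ) : Prop :=
  ∀ p ∈ orthant 2, ∀ x ∈ orthant 2,
    youngTransform f (fun i => p i * x i) =
      ((p 0) ^ (-r) * (x 0) ^ (-r) + (p 1) ^ (-r) * (x 1) ^ (-r)) ^ (-1 / r)

/-- The Cobb–Douglas production function. -/
def cobbDouglas (C α₁ α₂ : ℝ) (l : Fin 2 → ℝ) : ℝ :=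
  C * (l 0) ^ (α₁ / (α₁ + α₂ + 1)) * (l 1) ^ (α₂ / (α₁ + α₂ + 1))

/-- The constant `A`. -/
def constA (C α₁ α₂ : ℝ) : ℝ :=
  C ^ (α₁ + α₂ + 1) * ((α₁ + α₂) * α₁ ^ α₁ * α₂ ^ α₂ / (α₁ + α₂ + 1) ^ (α₁ + α₂)) *
    (1 / ProbabilityTheory.beta α₁ α₂)

/-- The constant `A_r`. -/
def constAr (C α₁ α₂ r : ℝ) : ℝ :=
  (-r) * constA C α₁ α₂ * (ProbabilityTheory.beta α₁ α₂ / ProbabilityTheory.beta (-α₁ / r) (-α₂ / r))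

/-- The distribution of capacities `A_r x₁^{α₁-1} x₂^{α₂-1} dx` on the non-negative quadrant. -/
def capacityMeasure (C α₁ α₂ r : ℝ) : Measure (Fin 2 → ℝ) :=
  (volume.restrict (orthant 2)).withDensity fun x =>
    ENNReal.ofReal (constAr C α₁ α₂ r * (x 0) ^ (α₁ - 1) * (x 1) ^ (α₂ - 1))

end

/-! Put ρ = -r ∈ (0, 1]. The proof is price duality. At input prices p, technology x has unit cost
`cesCost ρ (p ∘ x)` and is profitable exactly when (p₁x₁)^ρ + (p₂x₂)^ρ ≤ 1. By Shephard's lemma the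
cheapest unit input is forced to be the gradient of the cost, so every neoclassical f with this cost
equals 1 there (`IsNeoclassical.apply_cesGradient`); nothing else about f at these points is needed.

Run the profitable technologies at these inputs and leave the others idle. This maximizes output
minus expenditure technology by technology (`profit_le_profit_cesDemand`). Integrating, any
admissible u has output at most that of this plan plus p · (∫u - ∫u*), where u* is the plan; if the
plan uses exactly l, the last term is ≤ 0 and the plan is optimal.

It remains to find p. Take the marginal products of the Cobb–Douglas function at l. Dirichlet
integrals over the profitable region (`setLIntegral_orthant_dirichlet`) show that the total demand
is then l and the working capacity is `cobbDouglas C α₁ α₂ l`. If some l_j vanishes, no positive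
output is possible and the zero plan is optimal.

Existence of f: the infimum of the linear forms v ↦ q · v over the level set where the cost is 1. -/

open scoped ENNReal

/-! ### The CES cost and its gradient -/

/-- The constant elasticity of substitution unit cost `(q₁^ρ + q₂^ρ)^{1/ρ}`. -/
noncomputable def cesCost (ρ : ℝ) (q : Fin 2 → ℝ) : ℝ := (q 0 ^ ρ + q 1 ^ ρ) ^ (1 / ρ)

/-- The gradient of `cesCost ρ` at a point with positive coordinates. -/
noncomputable def cesGradient (ρ : ℝ) (q : Fin 2 → ℝ) (j : Fin 2) : ℝ :=
  q j ^ (ρ - 1) * (q 0 ^ ρ + q 1 ^ ρ) ^ (1 / ρ - 1)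

lemma cesCost_nonneg (ρ : ℝ) {q : Fin 2 → ℝ} (hq : q ∈ orthant 2) : 0 ≤ cesCost ρ q := by
  have h0 := hq 0
  have h1 := hq 1
  unfold cesCost
  positivity

lemma cesCost_pos (ρ : ℝ) {q : Fin 2 → ℝ} (hq : ∀ i, 0 < q i) : 0 < cesCost ρ q := by
  have h0 := hq 0
  have h1 := hq 1
  unfold cesCost
  positivity

lemma continuous_cesCost {ρ : ℝ} (hρ : 0 < ρ) : Continuous (cesCost ρ) := by
  unfold cesCost
  have h : 0 ≤ 1 / ρ := by positivity
  exact (((continuous_apply 0).rpow_const fun _ => Or.inr hρ.le).add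
    ((continuous_apply 1).rpow_const fun _ => Or.inr hρ.le)).rpow_const fun _ => Or.inr h

lemma cesCost_smul {ρ c : ℝ} (hρ : 0 < ρ) (hc : 0 ≤ c) {q : Fin 2 → ℝ} (hq : q ∈ orthant 2) :
    cesCost ρ (c • q) = c * cesCost ρ q := by
  have h0 := hq 0
  have h1 := hq 1
  simp only [cesCost, Pi.smul_apply, smul_eq_mul]
  rw [Real.mul_rpow hc h0, Real.mul_rpow hc h1, ← mul_add, Real.mul_rpow (by positivity)
    (by positivity), ← Real.rpow_mul hc, mul_one_div_cancel hρ.ne', Real.rpow_one]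

lemma cesGradient_nonneg (ρ : ℝ) {q : Fin 2 → ℝ} (hq : q ∈ orthant 2) :
    cesGradient ρ q ∈ orthant 2 := by
  intro j
  have h0 := hq 0
  have h1 := hq 1
  have hj := hq j
  unfold cesGradient
  positivity

lemma sum_mul_cesGradient {ρ : ℝ} {q : Fin 2 → ℝ} (hq : ∀ i, 0 < q i) :
    ∑ i, q i * cesGradient ρ q i = cesCost ρ q := by
  have h0 := hq 0
  have h1 := hq 1
  have hH : 0 < q 0 ^ ρ + q 1 ^ ρ := by positivity
  have hm (i : Fin 2) : q i * q i ^ (ρ - 1) = q i ^ ρ := by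
    rw [Real.rpow_sub_one (hq i).ne']
    field_simp [(hq i).ne']
  simp only [Fin.sum_univ_two, cesGradient, cesCost, ← mul_assoc, hm, ← add_mul]
  rw [Real.rpow_sub_one hH.ne']
  field_simp

/-- The gradient of the CES cost is a supergradient. -/
lemma cesCost_le_sum_mul_cesGradient {ρ : ℝ} (hρ : 0 < ρ) (hρ₁ : ρ ≤ 1) {q q' : Fin 2 → ℝ}
    (hq : ∀ i, 0 < q i) (hq' : q' ∈ orthant 2) :
    cesCost ρ q' ≤ ∑ i, q' i * cesGradient ρ q i := by
  have h0 := hq 0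
  have h1 := hq 1
  have h0' := hq' 0
  have h1' := hq' 1
  set H := q 0 ^ ρ + q 1 ^ ρ with hHdef
  have hH : 0 < H := by positivity
  have hx : q' 0 / q 0 ∈ Set.Ici (0 : ℝ) := div_nonneg h0' h0.le
  have hy : q' 1 / q 1 ∈ Set.Ici (0 : ℝ) := div_nonneg h1' h1.le
  have ha : 0 ≤ q 0 ^ ρ / H := by positivity
  have hb : 0 ≤ q 1 ^ ρ / H := by positivity
  -- Jensen for t ↦ t^ρ with weights q_i^ρ / H at the points q'_i / q_i; the weighted mean of these
  -- points is the claimed right-hand side divided by H^(1/ρ).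
  have hJ := (Real.concaveOn_rpow hρ.le hρ₁).2 hx hy ha hb (by rw [← add_div, div_self hH.ne'])
  simp only [smul_eq_mul] at hJ
  rw [Real.div_rpow h0' h0.le, Real.div_rpow h1' h1.le] at hJ
  have hL : q 0 ^ ρ / H * (q' 0 ^ ρ / q 0 ^ ρ) + q 1 ^ ρ / H * (q' 1 ^ ρ / q 1 ^ ρ)
      = (q' 0 ^ ρ + q' 1 ^ ρ) / H := by
    have : q 0 ^ ρ ≠ 0 := by positivity
    have : q 1 ^ ρ ≠ 0 := by positivity
    field_simp
  have hR : q 0 ^ ρ / H * (q' 0 / q 0) + q 1 ^ ρ / H * (q' 1 / q 1)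
      = (∑ i, q' i * cesGradient ρ q i) / H ^ (1 / ρ) := by
    have : H ^ (1 / ρ) ≠ 0 := by positivity
    simp only [Fin.sum_univ_two, cesGradient, ← hHdef]
    rw [Real.rpow_sub_one hH.ne', Real.rpow_sub_one h0.ne', Real.rpow_sub_one h1.ne']
    field_simp
  have hS : 0 ≤ ∑ i, q' i * cesGradient ρ q i :=
    Finset.sum_nonneg fun i _ => mul_nonneg (hq' i) (cesGradient_nonneg ρ (fun i => (hq i).le) i)
  rw [hL, hR, Real.div_rpow hS (by positivity), ← Real.rpow_mul hH.le,
    one_div_mul_cancel hρ.ne', Real.rpow_one, div_le_div_iff_of_pos_right hH] at hJ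
  have := Real.rpow_le_rpow (z := 1 / ρ) (by positivity) hJ (by positivity)
  rwa [← Real.rpow_mul hS, mul_one_div_cancel hρ.ne', Real.rpow_one] at this

/-- Shephard's lemma in one coordinate: the linear form majorizes the cost along the line and
touches it at a, so their difference has a minimum there and its derivative vanishes. -/
lemma supergradient_coord_eq {ρ a b v w : ℝ} (hρ : 0 < ρ) (ha : 0 < a) (hb : 0 < b)
    (heq : a * v + b * w = (a ^ ρ + b ^ ρ) ^ (1 / ρ))
    (hle : ∀ t, 0 < t → (t ^ ρ + b ^ ρ) ^ (1 / ρ) ≤ t * v + b * w) :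
    v = a ^ (ρ - 1) * (a ^ ρ + b ^ ρ) ^ (1 / ρ - 1) := by
  have hmin : IsLocalMin (fun t => t * v + b * w - (t ^ ρ + b ^ ρ) ^ (1 / ρ)) a := by
    filter_upwards [lt_mem_nhds ha] with t ht
    rw [heq, sub_self]
    exact sub_nonneg.2 (hle t ht)
  have hH : a ^ ρ + b ^ ρ ≠ 0 := by positivity
  have hd : HasDerivAt (fun t => t * v + b * w - (t ^ ρ + b ^ ρ) ^ (1 / ρ))
      (1 * v - (ρ * a ^ (ρ - 1)) * (1 / ρ) * (a ^ ρ + b ^ ρ) ^ (1 / ρ - 1)) a :=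
    (((hasDerivAt_id a).mul_const v).add_const _).sub
      (((Real.hasDerivAt_rpow_const (Or.inl ha.ne')).add_const _).rpow_const (Or.inl hH))
  have := hmin.hasDerivAt_eq_zero hd
  rw [one_mul, sub_eq_zero] at this
  rw [this]
  field_simp

/-! ### Young transform and cost-minimal inputs -/

lemma sum_mul_nonneg_of_mem_orthant {n : ℕ} {p v : Fin n → ℝ} (hp : p ∈ orthant n)
    (hv : v ∈ orthant n) : 0 ≤ ∑ i, p i * v i :=
  Finset.sum_nonneg fun i _ => mul_nonneg (hp i) (hv i)

lemma youngTransform_le {n : ℕ} (f : (Fin n → ℝ) → ℝ) {p v : Fin n → ℝ} (hp : p ∈ orthant n)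
    (hv : v ∈ orthant n) (hf : 0 < f v) : youngTransform f p ≤ (∑ i, p i * v i) / f v := by
  refine csInf_le ⟨0, ?_⟩ ⟨v, hv, hf, rfl⟩
  rintro y ⟨w, hw, hfw, rfl⟩
  exact div_nonneg (sum_mul_nonneg_of_mem_orthant hp hw) hfw.le

lemma youngTransform_nonneg {n : ℕ} (f : (Fin n → ℝ) → ℝ) {p : Fin n → ℝ}
    (hp : p ∈ orthant n) : 0 ≤ youngTransform f p := by
  refine Real.sInf_nonneg ?_
  rintro y ⟨w, hw, hfw, rfl⟩
  exact div_nonneg (sum_mul_nonneg_of_mem_orthant hp hw) hfw.le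

/-- Fenchel–Young inequality for the Young transform. -/
lemma youngTransform_mul_le {n : ℕ} (f : (Fin n → ℝ) → ℝ) {p v : Fin n → ℝ}
    (hp : p ∈ orthant n) (hv : v ∈ orthant n) : youngTransform f p * f v ≤ ∑ i, p i * v i := by
  rcases le_or_gt (f v) 0 with h | h
  · exact (mul_nonpos_of_nonneg_of_nonpos (youngTransform_nonneg f hp) h).trans
      (sum_mul_nonneg_of_mem_orthant hp hv)
  · exact (le_div_iff₀ h).1 (youngTransform_le f hp hv h)

lemma isClosed_orthant (n : ℕ) : IsClosed (orthant n) := by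
  have : orthant n = ⋂ i, {x | 0 ≤ x i} := by ext; simp [orthant]
  rw [this]
  exact isClosed_iInter fun i => isClosed_le continuous_const (continuous_apply i)

lemma isCompact_budgetSet {n : ℕ} {q : Fin n → ℝ} (hq : ∀ i, 0 < q i) (c : ℝ) :
    IsCompact {v | v ∈ orthant n ∧ ∑ i, q i * v i ≤ c} := by
  refine (isCompact_Icc (a := (0 : Fin n → ℝ)) (b := fun i => c / q i)).of_isClosed_subset ?_ ?_
  · exact (isClosed_orthant n).inter (isClosed_le
      (continuous_finsetSum _ fun i _ => continuous_const.mul (continuous_apply i))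
      continuous_const)
  · rintro v ⟨hv, hc⟩
    refine ⟨hv, fun i => ?_⟩
    rw [le_div_iff₀ (hq i), mul_comm]
    exact (Finset.single_le_sum (f := fun i => q i * v i)
      (fun i _ => mul_nonneg (hq i).le (hv i)) (Finset.mem_univ i)).trans hc

/-- At positive prices with positive unit cost, cost-minimal production of one unit exists. -/
lemma IsNeoclassical.exists_cost_minimizer {n : ℕ} {f : (Fin n → ℝ) → ℝ} (hf : IsNeoclassical f)
    {q : Fin n → ℝ} (hq : ∀ i, 0 < q i) (hpos : 0 < youngTransform f q) :
    ∃ v ∈ orthant n, f v = 1 ∧ ∑ i, q i * v i = youngTransform f q := by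
  set h := youngTransform f q with hh
  set S := {y | ∃ v ∈ orthant n, 0 < f v ∧ y = (∑ i, q i * v i) / f v} with hS
  have hq' : q ∈ orthant n := fun i => (hq i).le
  have hne : S.Nonempty := by
    by_contra hemp
    rw [Set.not_nonempty_iff_eq_empty] at hemp
    have : h = sInf S := rfl
    rw [hemp, Real.sInf_empty] at this
    exact hpos.ne' this
  have hnorm : ∀ v ∈ orthant n, 0 < f v → (f v)⁻¹ • v ∈ orthant n ∧ f ((f v)⁻¹ • v) = 1 ∧
      ∑ i, q i * ((f v)⁻¹ • v) i = (∑ i, q i * v i) / f v := by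
    intro v hv hfv
    refine ⟨fun i => mul_nonneg (inv_nonneg.2 hfv.le) (hv i), ?_, ?_⟩
    · rw [hf.homogeneous _ (inv_pos.2 hfv) v hv, inv_mul_cancel₀ hfv.ne']
    · rw [div_eq_inv_mul, Finset.mul_sum]
      exact Finset.sum_congr rfl fun i _ => by simp only [Pi.smul_apply, smul_eq_mul]; ring
  -- The slack 1 in the budget makes K nonempty. The constraint f ≥ 1 is closed; equality is
  -- recovered at the minimizer from h * f v ≤ h with h > 0.
  set K := {v | v ∈ orthant n ∧ ∑ i, q i * v i ≤ h + 1} ∩ f ⁻¹' Set.Ici 1 with hKdef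
  have hKc : IsCompact K := by
    have hB := isCompact_budgetSet hq (h + 1)
    exact hB.of_isClosed_subset ((hf.continuous.mono fun v hv => hv.1).preimage_isClosed_of_isClosed
      hB.isClosed isClosed_Ici) Set.inter_subset_left
  have hKne : K.Nonempty := by
    obtain ⟨y, ⟨v, hv, hfv, rfl⟩, hlt⟩ := exists_lt_of_csInf_lt hne (lt_add_one h)
    obtain ⟨h1, h2, h3⟩ := hnorm v hv hfv
    exact ⟨_, ⟨h1, h3.trans_le hlt.le⟩, h2.ge⟩
  obtain ⟨v, ⟨⟨hv, hvc⟩, hfv⟩, hmin⟩ := hKc.exists_isMinOn hKne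
    (f := fun v : Fin n → ℝ => ∑ i, q i * v i)
    (continuous_finsetSum _ fun i _ => continuous_const.mul (continuous_apply i)).continuousOn
  have hfv : 1 ≤ f v := hfv
  have hle : ∑ i, q i * v i ≤ h := by
    refine le_csInf hne ?_
    rintro y ⟨w, hw, hfw, rfl⟩
    obtain ⟨h1, h2, h3⟩ := hnorm w hw hfw
    rcases le_or_gt ((∑ i, q i * w i) / f w) (h + 1) with hc | hc
    · rw [← h3]
      exact hmin (show _ ∈ K from ⟨⟨h1, h3.trans_le hc⟩, h2.ge⟩)
    · exact hvc.trans hc.le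
  have hge := youngTransform_mul_le f hq' hv
  rw [← hh] at hge
  have hone : f v = 1 := le_antisymm (by nlinarith) hfv
  refine ⟨v, hv, hone, le_antisymm hle ?_⟩
  rwa [hone, mul_one] at hge

/-- A neoclassical function with CES unit cost equals one on the gradients of the cost. -/
lemma IsNeoclassical.apply_cesGradient {ρ : ℝ} (hρ : 0 < ρ) {f : (Fin 2 → ℝ) → ℝ}
    (hf : IsNeoclassical f) (hcost : ∀ q ∈ orthant 2, youngTransform f q = cesCost ρ q)
    {q : Fin 2 → ℝ} (hq : ∀ i, 0 < q i) : f (cesGradient ρ q) = 1 := by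
  have hq' : q ∈ orthant 2 := fun i => (hq i).le
  obtain ⟨v, hv, hfv, hmin⟩ := hf.exists_cost_minimizer hq (by
    rw [hcost q hq']; exact cesCost_pos ρ hq)
  -- The minimizer v at the fixed price q still obeys the Fenchel–Young inequality at all other
  -- prices, so it is a supergradient of the cost at q.
  have hle (a b : ℝ) (ha : 0 < a) (hb : 0 < b) :
      (a ^ ρ + b ^ ρ) ^ (1 / ρ) ≤ a * v 0 + b * v 1 := by
    have hm : ![a, b] ∈ orthant 2 := by
      intro i
      fin_cases i
      · exact ha.le
      · exact hb.le
    have := youngTransform_mul_le f hm hv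
    rw [hfv, mul_one, hcost _ hm] at this
    simpa [cesCost, Fin.sum_univ_two] using this
  rw [hcost q hq', Fin.sum_univ_two, cesCost] at hmin
  have e : v = cesGradient ρ q := by
    funext j
    fin_cases j
    · exact supergradient_coord_eq hρ (hq 0) (hq 1) hmin fun t ht => hle _ _ ht (hq 1)
    · have := supergradient_coord_eq hρ (hq 1) (hq 0) (v := v 1) (w := v 0)
        (by rw [add_comm, hmin, add_comm])
        fun t ht => by simpa only [add_comm] using hle _ _ (hq 0) ht
      simpa [cesGradient, add_comm] using this
  rw [← e, hfv]

/-! ### Existence: the production function dual to the CES cost -/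

/-- The neoclassical function dual to the CES cost. -/
noncomputable def cesProduction (ρ : ℝ) (v : Fin 2 → ℝ) : ℝ :=
  ⨅ q : {q : Fin 2 → ℝ // q ∈ orthant 2 ∧ cesCost ρ q = 1}, ∑ i, q.1 i * v i

lemma cesProduction_nonneg (ρ : ℝ) {v : Fin 2 → ℝ} (hv : v ∈ orthant 2) :
    0 ≤ cesProduction ρ v :=
  Real.iInf_nonneg fun q => sum_mul_nonneg_of_mem_orthant q.2.1 hv

lemma cesProduction_le {ρ : ℝ} {q v : Fin 2 → ℝ} (hq : q ∈ orthant 2) (hq₁ : cesCost ρ q = 1)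
    (hv : v ∈ orthant 2) : cesProduction ρ v ≤ ∑ i, q i * v i := by
  refine ciInf_le (f := fun q : {q : Fin 2 → ℝ // q ∈ orthant 2 ∧ cesCost ρ q = 1} =>
    ∑ i, q.1 i * v i) ⟨0, ?_⟩ ⟨q, hq, hq₁⟩
  rintro _ ⟨q, rfl⟩
  exact sum_mul_nonneg_of_mem_orthant q.2.1 hv

lemma nonempty_cesCost_eq_one {ρ : ℝ} (hρ : 0 < ρ) :
    Nonempty {q : Fin 2 → ℝ // q ∈ orthant 2 ∧ cesCost ρ q = 1} := by
  refine ⟨⟨![1, 0], fun i => ?_, ?_⟩⟩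
  · fin_cases i <;> simp
  · simp [cesCost, Real.zero_rpow hρ.ne']

lemma cesCost_mul_cesProduction_le {ρ : ℝ} (hρ : 0 < ρ) {q v : Fin 2 → ℝ} (hq : q ∈ orthant 2)
    (hv : v ∈ orthant 2) : cesCost ρ q * cesProduction ρ v ≤ ∑ i, q i * v i := by
  rcases (cesCost_nonneg ρ hq).eq_or_lt with h | h
  · rw [← h, zero_mul]
    exact sum_mul_nonneg_of_mem_orthant hq hv
  · have hm : (cesCost ρ q)⁻¹ • q ∈ orthant 2 := fun i => mul_nonneg (inv_nonneg.2 h.le) (hq i)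
    have := cesProduction_le hm (by rw [cesCost_smul hρ (inv_nonneg.2 h.le) hq,
      inv_mul_cancel₀ h.ne']) hv
    simp only [Pi.smul_apply, smul_eq_mul, mul_assoc, ← Finset.mul_sum] at this
    rwa [← div_eq_inv_mul, le_div_iff₀ h, mul_comm] at this

lemma coord_le_one_of_cesCost_eq_one {ρ : ℝ} (hρ : 0 < ρ) {q : Fin 2 → ℝ} (hq : q ∈ orthant 2)
    (hq₁ : cesCost ρ q = 1) (i : Fin 2) : q i ≤ 1 := by
  have h0 := hq 0
  have h1 := hq 1
  have hH : q 0 ^ ρ + q 1 ^ ρ = 1 := by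
    have : (cesCost ρ q) ^ ρ = 1 := by rw [hq₁, Real.one_rpow]
    rwa [cesCost, ← Real.rpow_mul (by positivity), one_div_mul_cancel hρ.ne',
      Real.rpow_one] at this
  have h0' : 0 ≤ q 0 ^ ρ := by positivity
  have h1' : 0 ≤ q 1 ^ ρ := by positivity
  rw [← Real.rpow_le_rpow_iff (hq i) zero_le_one hρ, Real.one_rpow]
  fin_cases i
  · exact show q 0 ^ ρ ≤ 1 by linarith
  · exact show q 1 ^ ρ ≤ 1 by linarith

/-- Homogeneity and concavity pass to an infimum of linear forms. The coefficients lie in [0, 1], so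
in the sup metric each of the two terms changes by at most the distance; the common Lipschitz
constant 2 gives continuity up to the boundary. -/
lemma isNeoclassical_cesProduction {ρ : ℝ} (hρ : 0 < ρ) : IsNeoclassical (cesProduction ρ) where
  homogeneous c hc v _ := by
    simp only [cesProduction, Real.mul_iInf_of_nonneg hc.le, Pi.smul_apply, smul_eq_mul,
      Finset.mul_sum]
    exact iInf_congr fun q => Finset.sum_congr rfl fun i _ => by ring
  concave := by
    refine ⟨fun x hx y hy a b ha hb _ i => ?_, fun x hx y hy a b ha hb _ => ?_⟩
    · exact add_nonneg (mul_nonneg ha (hx i)) (mul_nonneg hb (hy i))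
    · have := nonempty_cesCost_eq_one hρ
      refine le_ciInf fun q => ?_
      have h1 := mul_le_mul_of_nonneg_left (cesProduction_le q.2.1 q.2.2 hx) ha
      have h2 := mul_le_mul_of_nonneg_left (cesProduction_le q.2.1 q.2.2 hy) hb
      simp only [Fin.sum_univ_two, Pi.add_apply, Pi.smul_apply, smul_eq_mul] at h1 h2 ⊢
      linarith
  continuous := by
    refine (LipschitzOnWith.of_le_add_mul (K := 2) fun v hv w hw => ?_).continuousOn
    have := nonempty_cesCost_eq_one hρ
    rw [← sub_le_iff_le_add]
    refine le_ciInf fun q => ?_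
    have h1 := cesProduction_le q.2.1 q.2.2 hv
    have h2 (i : Fin 2) : q.1 i * v i - q.1 i * w i ≤ dist v w := by
      rw [← mul_sub]
      have ha : q.1 i * (v i - w i) ≤ q.1 i * |v i - w i| :=
        mul_le_mul_of_nonneg_left (le_abs_self _) (q.2.1 i)
      have hb : q.1 i * |v i - w i| ≤ |v i - w i| :=
        mul_le_of_le_one_left (abs_nonneg _) (coord_le_one_of_cesCost_eq_one hρ q.2.1 q.2.2 i)
      exact (ha.trans hb).trans (dist_le_pi_dist v w i)
    have h20 := h2 0
    have h21 := h2 1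
    simp only [Fin.sum_univ_two, NNReal.coe_ofNat] at h1 ⊢
    linarith

lemma one_le_cesProduction_cesGradient {ρ : ℝ} (hρ : 0 < ρ) (hρ₁ : ρ ≤ 1) {q : Fin 2 → ℝ}
    (hq : ∀ i, 0 < q i) : 1 ≤ cesProduction ρ (cesGradient ρ q) := by
  have := nonempty_cesCost_eq_one hρ
  refine le_ciInf fun q' => ?_
  exact q'.2.2.symm.trans_le (cesCost_le_sum_mul_cesGradient hρ hρ₁ hq q'.2.1)

/-- Gradient inputs give the upper bound, but the gradient formula is only usable at positive
prices; hence the prices are shifted by ε > 0 and ε tends to 0. -/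
lemma youngTransform_cesProduction {ρ : ℝ} (hρ : 0 < ρ) (hρ₁ : ρ ≤ 1) {q : Fin 2 → ℝ}
    (hq : q ∈ orthant 2) : youngTransform (cesProduction ρ) q = cesCost ρ q := by
  apply le_antisymm
  · have hcont : Continuous fun ε : ℝ => cesCost ρ fun i => q i + ε :=
      (continuous_cesCost hρ).comp (by fun_prop)
    have hlim : Filter.Tendsto (fun ε : ℝ => cesCost ρ fun i => q i + ε)
        (nhdsWithin 0 (Set.Ioi 0)) (nhds (cesCost ρ q)) := by
      simpa using (hcont.tendsto 0).mono_left nhdsWithin_le_nhds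
    refine ge_of_tendsto hlim ?_
    filter_upwards [self_mem_nhdsWithin] with ε hε
    have hε : 0 < ε := hε
    have hqε : ∀ i, 0 < q i + ε := fun i => add_pos_of_nonneg_of_pos (hq i) hε
    have hg := cesGradient_nonneg ρ (q := fun i => q i + ε) fun i => (hqε i).le
    have h1 := one_le_cesProduction_cesGradient hρ hρ₁ hqε
    refine (youngTransform_le _ hq hg (by linarith)).trans ?_
    refine (div_le_self (sum_mul_nonneg_of_mem_orthant hq hg) h1).trans ?_
    rw [← sum_mul_cesGradient hqε]
    exact Finset.sum_le_sum fun i _ => mul_le_mul_of_nonneg_right (by linarith) (hg i)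
  · have hone : ∀ i : Fin 2, (0 : ℝ) < (1 : Fin 2 → ℝ) i := fun i => one_pos
    have h1 := one_le_cesProduction_cesGradient hρ hρ₁ hone
    refine le_csInf ⟨_, cesGradient ρ 1, cesGradient_nonneg ρ fun i => (hone i).le,
      by linarith, rfl⟩ ?_
    rintro y ⟨v, hv, hfv, rfl⟩
    rw [le_div_iff₀ hfv]
    exact cesCost_mul_cesProduction_le hρ hq hv

lemma hasCESUnitCost_iff {r : ℝ} {f : (Fin 2 → ℝ) → ℝ} :
    HasCESUnitCost r f ↔ ∀ q ∈ orthant 2, youngTransform f q = cesCost (-r) q := by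
  constructor
  · intro h q hq
    simpa [cesCost, neg_div, div_neg] using h q hq 1 fun _ => zero_le_one
  · intro h p hp x hx
    rw [h _ fun i => mul_nonneg (hp i) (hx i), cesCost, Real.mul_rpow (hp 0) (hx 0),
      Real.mul_rpow (hp 1) (hx 1), neg_div, div_neg]

lemma exists_isNeoclassical_hasCESUnitCost {r : ℝ} (hr₁ : -1 ≤ r) (hr₂ : r < 0) :
    ∃ f : (Fin 2 → ℝ) → ℝ,
      IsNeoclassical f ∧ (∀ v ∈ orthant 2, 0 ≤ f v) ∧ HasCESUnitCost r f :=
  have hρ : 0 < -r := by linarith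
  ⟨cesProduction (-r), isNeoclassical_cesProduction hρ, fun _ => cesProduction_nonneg _,
    hasCESUnitCost_iff.2 fun _ => youngTransform_cesProduction hρ (by linarith)⟩

/-! ### Beta and Dirichlet integrals -/

lemma image_mul_rpow_Ioi {p ρ : ℝ} (hp : 0 < p) (hρ : 0 < ρ) :
    (fun x : ℝ => (p * x) ^ ρ) '' Set.Ioi 0 = Set.Ioi 0 := by
  ext y
  constructor
  · rintro ⟨x, hx, rfl⟩
    exact Real.rpow_pos_of_pos (mul_pos hp hx) _
  · intro hy
    have hy : 0 < y := hy
    refine ⟨y ^ (1 / ρ) / p, div_pos (Real.rpow_pos_of_pos hy _) hp, ?_⟩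
    simp only
    rw [mul_div_cancel₀ _ hp.ne', ← Real.rpow_mul hy.le, one_div_mul_cancel hρ.ne', Real.rpow_one]

/-- The substitution `y = (p x)^ρ` in Mellin-type integrals. -/
lemma lintegral_rpow_mul_comp_mul_rpow {p ρ : ℝ} (hp : 0 < p) (hρ : 0 < ρ) (α : ℝ)
    (g : ℝ → ℝ≥0∞) :
    ∫⁻ x in Set.Ioi 0, ENNReal.ofReal (x ^ (α - 1)) * g ((p * x) ^ ρ) =
      ENNReal.ofReal (p ^ (-α) / ρ) *
        ∫⁻ y in Set.Ioi 0, ENNReal.ofReal (y ^ (α / ρ - 1)) * g y := by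
  have hderiv : ∀ x ∈ Set.Ioi (0 : ℝ), HasDerivWithinAt (fun x : ℝ => (p * x) ^ ρ)
      (p * 1 * ρ * (p * x) ^ (ρ - 1)) (Set.Ioi 0) x := fun x hx =>
    (((hasDerivAt_id x).const_mul p).rpow_const
      (Or.inl (mul_pos hp hx).ne')).hasDerivWithinAt
  have hinj : Set.InjOn (fun x : ℝ => (p * x) ^ ρ) (Set.Ioi 0) := by
    intro x hx y hy hxy
    exact mul_left_cancel₀ hp.ne' (Real.rpow_left_injOn hρ.ne' (mul_pos hp hx).le
      (mul_pos hp hy).le hxy)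
  have := lintegral_image_eq_lintegral_abs_deriv_mul measurableSet_Ioi hderiv hinj
    (fun y => ENNReal.ofReal (y ^ (α / ρ - 1)) * g y)
  rw [image_mul_rpow_Ioi hp hρ] at this
  rw [this, ← lintegral_const_mul' _ _ ENNReal.ofReal_ne_top]
  refine setLIntegral_congr_fun measurableSet_Ioi fun x hx => ?_
  have hx : 0 < x := hx
  have hpx : 0 < p * x := mul_pos hp hx
  rw [← mul_assoc, ← mul_assoc, ← ENNReal.ofReal_mul (by positivity),
    ← ENNReal.ofReal_mul (by positivity), abs_of_nonneg (by positivity)]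
  congr 2
  rw [← Real.rpow_mul hpx.le, mul_sub, mul_div_cancel₀ _ hρ.ne', mul_one]
  have e : (p * x) ^ (ρ - 1) * (p * x) ^ (α - ρ) = p ^ α / p * x ^ (α - 1) := by
    rw [← Real.rpow_add hpx, Real.mul_rpow hp.le hx.le, ← Real.rpow_sub_one hp.ne']
    ring_nf
  have : p ^ α ≠ 0 := by positivity
  calc x ^ (α - 1) = p ^ (-α) / ρ * (p * 1 * ρ) * (p ^ α / p * x ^ (α - 1)) := by
        rw [Real.rpow_neg hp.le]; field_simp
    _ = _ := by rw [← e]; ac_rfl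

/-- The beta integral over `(0, t)`. -/
lemma lintegral_rpow_mul_sub_rpow {a b t : ℝ} (ha : 0 < a) (hb : 0 < b) (ht : 0 < t) :
    ∫⁻ y in Set.Ioo 0 t, ENNReal.ofReal (y ^ (a - 1) * (t - y) ^ (b - 1)) =
      ENNReal.ofReal (t ^ (a + b - 1) * ProbabilityTheory.beta a b) := by
  have hB := ProbabilityTheory.beta_pos ha hb
  have himg : (fun z : ℝ => t * z) '' Set.Ioo 0 1 = Set.Ioo 0 t := by
    rw [Set.image_mul_left_Ioo ht, mul_zero, mul_one]
  have hderiv : ∀ x ∈ Set.Ioo (0 : ℝ) 1, HasDerivWithinAt (fun z : ℝ => t * z) (t * 1)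
      (Set.Ioo 0 1) x := fun x _ => ((hasDerivAt_id x).const_mul t).hasDerivWithinAt
  rw [← himg, lintegral_image_eq_lintegral_abs_deriv_mul measurableSet_Ioo hderiv
    (mul_right_injective₀ ht.ne').injOn]
  -- The value of the integral over (0, 1) is read off from the normalization of the beta density.
  have h1 := ProbabilityTheory.lintegral_betaPDF_eq_one ha hb
  rw [ProbabilityTheory.lintegral_betaPDF] at h1
  rw [← mul_one (ENNReal.ofReal (t ^ (a + b - 1) * ProbabilityTheory.beta a b)), ← h1,
    ← lintegral_const_mul' _ _ ENNReal.ofReal_ne_top]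
  refine setLIntegral_congr_fun measurableSet_Ioo fun z hz => ?_
  have hz0 : 0 < z := hz.1
  have hz1 : 0 < 1 - z := sub_pos.2 hz.2
  rw [← ENNReal.ofReal_mul (by positivity), ← ENNReal.ofReal_mul (by positivity)]
  congr 1
  have e1 : t - t * z = t * (1 - z) := by ring
  have e2 : a + b - 1 = 1 + (a - 1) + (b - 1) := by ring
  rw [mul_one, abs_of_pos ht, e1, Real.mul_rpow ht.le hz0.le, Real.mul_rpow ht.le hz1.le, e2,
    Real.rpow_add ht, Real.rpow_add ht, Real.rpow_one]
  field_simp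

lemma lintegral_Ioc_rpow {s : ℝ} (hs : 0 < s) :
    ∫⁻ t in Set.Ioc (0 : ℝ) 1, ENNReal.ofReal (t ^ (s - 1)) = ENNReal.ofReal (1 / s) := by
  have hs' : -1 < s - 1 := by linarith
  rw [← ofReal_integral_eq_lintegral_ofReal, ← intervalIntegral.integral_of_le zero_le_one,
    integral_rpow (Or.inl hs')]
  · simp [Real.zero_rpow hs.ne']
  · exact (intervalIntegral.intervalIntegrable_rpow' hs').1
  · filter_upwards [ae_restrict_mem measurableSet_Ioc] with t ht
    exact Real.rpow_nonneg ht.1.le _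

/-- A Dirichlet integral over the standard triangle. -/
lemma lintegral_triangle_rpow {a b c : ℝ} (ha : 0 < a) (hb : 0 < b) (hs : 0 < a + b + c) :
    ∫⁻ y in Set.Ioi 0, ENNReal.ofReal (y ^ (a - 1)) * ∫⁻ z in Set.Ioi 0,
      ENNReal.ofReal (z ^ (b - 1)) *
        (Set.Iic 1).indicator (fun t : ℝ => ENNReal.ofReal (t ^ c)) (y + z) =
      ENNReal.ofReal (ProbabilityTheory.beta a b / (a + b + c)) := by
  have hB := ProbabilityTheory.beta_pos ha hb
  set k : ℝ → ℝ≥0∞ := (Set.Iic 1).indicator (fun t : ℝ => ENNReal.ofReal (t ^ c)) with hk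
  have hkm : Measurable k := Measurable.indicator (by fun_prop) measurableSet_Iic
  set D : Set (ℝ × ℝ) := {w | 0 < w.1 ∧ w.1 < w.2} with hD
  have hDm : MeasurableSet D := (measurableSet_lt measurable_const measurable_fst).inter
    (measurableSet_lt measurable_fst measurable_snd)
  -- The integrand in the coordinates (y, t) with t = y + z, extended by zero off 0 < y < t. After
  -- Tonelli the integral in y is a beta integral, and a power of t remains on (0, 1].
  set F : ℝ → ℝ → ℝ≥0∞ := fun y t => D.indicator (fun w =>
    ENNReal.ofReal (w.1 ^ (a - 1) * (w.2 - w.1) ^ (b - 1)) * k w.2) (y, t) with hF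
  have hFm : Measurable (Function.uncurry F) := by
    refine Measurable.indicator ?_ hDm
    exact Measurable.mul (by fun_prop) (hkm.comp measurable_snd)
  have hleft : ∀ y ∈ Set.Ioi (0 : ℝ), (ENNReal.ofReal (y ^ (a - 1)) * ∫⁻ z in Set.Ioi 0,
      ENNReal.ofReal (z ^ (b - 1)) * k (y + z)) = ∫⁻ t, F y t := by
    intro y hy
    have hy : 0 < y := hy
    rw [← lintegral_const_mul' _ _ ENNReal.ofReal_ne_top, ← lintegral_indicator measurableSet_Ioi,
      ← lintegral_add_left_eq_self (F y) y]
    refine lintegral_congr fun z => ?_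
    by_cases hz : 0 < z
    · rw [Set.indicator_of_mem (show z ∈ Set.Ioi 0 from hz), hF]
      simp only
      rw [Set.indicator_of_mem (show (y, y + z) ∈ D from ⟨hy, by simpa using hz⟩), ← mul_assoc,
        ← ENNReal.ofReal_mul (by positivity), add_sub_cancel_left]
    · rw [Set.indicator_of_notMem (show z ∉ Set.Ioi 0 from hz), hF]
      simp only
      rw [Set.indicator_of_notMem fun h => hz (by simpa using h.2)]
  have hzero : ∀ y ∉ Set.Ioi (0 : ℝ), (∫⁻ t, F y t) = 0 := by
    intro y hy
    refine (lintegral_congr fun t => ?_).trans lintegral_zero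
    exact Set.indicator_of_notMem (fun h => hy h.1) _
  have hright : ∀ t, (∫⁻ y, F y t) = (Set.Ioc 0 1).indicator (fun t : ℝ =>
      ENNReal.ofReal (ProbabilityTheory.beta a b) * ENNReal.ofReal (t ^ (a + b + c - 1))) t := by
    intro t
    by_cases ht : 0 < t
    · have e : (∫⁻ y, F y t) = (∫⁻ y in Set.Ioo 0 t,
          ENNReal.ofReal (y ^ (a - 1) * (t - y) ^ (b - 1))) * k t := by
        rw [← lintegral_mul_const _ (by fun_prop), ← lintegral_indicator measurableSet_Ioo]
        rfl
      rw [e, lintegral_rpow_mul_sub_rpow ha hb ht, hk]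
      by_cases ht1 : t ≤ 1
      · rw [Set.indicator_of_mem (show t ∈ Set.Iic 1 from ht1), Set.indicator_of_mem
          (show t ∈ Set.Ioc 0 1 from ⟨ht, ht1⟩), ← ENNReal.ofReal_mul (by positivity),
          ← ENNReal.ofReal_mul (by positivity)]
        congr 1
        rw [show a + b + c - 1 = (a + b - 1) + c by ring, Real.rpow_add ht]
        ring
      · rw [Set.indicator_of_notMem (show t ∉ Set.Iic 1 from ht1), mul_zero,
          Set.indicator_of_notMem fun h => ht1 h.2]
    · rw [Set.indicator_of_notMem fun h => ht h.1]
      refine (lintegral_congr fun y => ?_).trans lintegral_zero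
      exact Set.indicator_of_notMem (fun h => ht (h.1.trans h.2)) _
  calc _ = ∫⁻ y in Set.Ioi 0, ∫⁻ t, F y t := setLIntegral_congr_fun measurableSet_Ioi hleft
    _ = ∫⁻ y, ∫⁻ t, F y t := setLIntegral_eq_of_support_subset fun y hy => by
        by_contra h; exact hy (hzero y h)
    _ = ∫⁻ t, ∫⁻ y, F y t := lintegral_lintegral_swap hFm.aemeasurable
    _ = ∫⁻ t in Set.Ioc 0 1, ENNReal.ofReal (ProbabilityTheory.beta a b) *
          ENNReal.ofReal (t ^ (a + b + c - 1)) := by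
        rw [lintegral_congr hright, lintegral_indicator measurableSet_Ioc]
    _ = _ := by
        rw [lintegral_const_mul' _ _ ENNReal.ofReal_ne_top, lintegral_Ioc_rpow hs,
          ← ENNReal.ofReal_mul hB.le, mul_one_div]

lemma orthant_eq_pi (n : ℕ) : orthant n = Set.univ.pi fun _ => Set.Ici 0 := by
  ext; simp [orthant, Pi.le_def]

lemma openOrthant_ae_eq_orthant (n : ℕ) :
    (Set.univ.pi fun _ : Fin n => Set.Ioi (0 : ℝ)) =ᵐ[volume] orthant n := by
  rw [orthant_eq_pi]
  exact Measure.pi_Ioi_ae_eq_pi_Ici (μ := fun _ => (volume : Measure ℝ)) (f := fun _ => 0)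

/-- Integrals over the non-negative quadrant as iterated integrals. -/
lemma setLIntegral_orthant_two {G : ℝ → ℝ → ℝ≥0∞} (hG : Measurable (Function.uncurry G)) :
    ∫⁻ x in orthant 2, G (x 0) (x 1) = ∫⁻ y in Set.Ioi 0, ∫⁻ z in Set.Ioi 0, G y z := by
  rw [← setLIntegral_congr (openOrthant_ae_eq_orthant 2)]
  have hpre : (Set.univ.pi fun _ : Fin 2 => Set.Ioi (0 : ℝ)) =
      MeasurableEquiv.finTwoArrow ⁻¹' (Set.Ioi 0 ×ˢ Set.Ioi 0) := by
    ext x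
    simp [Fin.forall_fin_two]
  have := (volume_preserving_finTwoArrow ℝ).setLIntegral_comp_preimage
    (measurableSet_Ioi.prod measurableSet_Ioi) hG (s := Set.Ioi 0 ×ˢ Set.Ioi 0)
  rw [hpre]
  refine this.trans ?_
  rw [Measure.volume_eq_prod, ← Measure.prod_restrict, lintegral_prod _ hG.aemeasurable]
  rfl

/-- The substitution `yᵢ = (pᵢ xᵢ)^ρ` in the quadrant. -/
lemma setLIntegral_orthant_rpow_mul_comp {p₁ p₂ ρ : ℝ} (hp₁ : 0 < p₁) (hp₂ : 0 < p₂) (hρ : 0 < ρ)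
    (α₁ α₂ : ℝ) {G : ℝ → ℝ → ℝ≥0∞} (hG : Measurable (Function.uncurry G)) :
    ∫⁻ x in orthant 2, ENNReal.ofReal ((x 0) ^ (α₁ - 1)) * (ENNReal.ofReal ((x 1) ^ (α₂ - 1)) *
        G ((p₁ * x 0) ^ ρ) ((p₂ * x 1) ^ ρ)) =
      ENNReal.ofReal (p₁ ^ (-α₁) / ρ) * (ENNReal.ofReal (p₂ ^ (-α₂) / ρ) *
        ∫⁻ y in Set.Ioi 0, ENNReal.ofReal (y ^ (α₁ / ρ - 1)) *
          ∫⁻ z in Set.Ioi 0, ENNReal.ofReal (z ^ (α₂ / ρ - 1)) * G y z) := by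
  rw [setLIntegral_orthant_two (G := fun y z => ENNReal.ofReal (y ^ (α₁ - 1)) *
    (ENNReal.ofReal (z ^ (α₂ - 1)) * G ((p₁ * y) ^ ρ) ((p₂ * z) ^ ρ)))]
  · simp_rw [lintegral_const_mul' _ _ ENNReal.ofReal_ne_top]
    simp_rw [lintegral_rpow_mul_comp_mul_rpow hp₂ hρ α₂]
    rw [lintegral_rpow_mul_comp_mul_rpow hp₁ hρ α₁ (fun y => ENNReal.ofReal (p₂ ^ (-α₂) / ρ) *
      ∫⁻ z in Set.Ioi 0, ENNReal.ofReal (z ^ (α₂ / ρ - 1)) * G y z)]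
    simp_rw [mul_left_comm (ENNReal.ofReal (_ ^ (α₁ / ρ - 1)))]
    rw [lintegral_const_mul' _ _ ENNReal.ofReal_ne_top]
  · refine Measurable.mul (by fun_prop) (Measurable.mul (by fun_prop) ?_)
    exact hG.comp (f := fun w : ℝ × ℝ => ((p₁ * w.1) ^ ρ, (p₂ * w.2) ^ ρ)) (by fun_prop)

lemma beta_add_one_left {a b : ℝ} (ha : 0 < a) (hb : 0 < b) :
    ProbabilityTheory.beta (a + 1) b = a / (a + b) * ProbabilityTheory.beta a b := by
  have h : Real.Gamma (a + b) ≠ 0 := (Real.Gamma_pos_of_pos (add_pos ha hb)).ne'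
  have hab : a + b ≠ 0 := (add_pos ha hb).ne'
  rw [ProbabilityTheory.beta, ProbabilityTheory.beta, Real.Gamma_add_one ha.ne',
    show a + 1 + b = a + b + 1 by ring, Real.Gamma_add_one hab]
  field_simp

lemma beta_add_one_right {a b : ℝ} (ha : 0 < a) (hb : 0 < b) :
    ProbabilityTheory.beta a (b + 1) = b / (a + b) * ProbabilityTheory.beta a b := by
  have h (x y : ℝ) : ProbabilityTheory.beta x y = ProbabilityTheory.beta y x := by
    rw [ProbabilityTheory.beta, ProbabilityTheory.beta, mul_comm, add_comm]
  rw [h, beta_add_one_left hb ha, h b a, add_comm b a]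

/-- The function `t ↦ t^c` cut off above `t = 1`. -/
noncomputable def cutoffRpow (c : ℝ) : ℝ → ℝ := (Set.Iic 1).indicator fun t => t ^ c

lemma measurable_cutoffRpow (c : ℝ) : Measurable (cutoffRpow c) :=
  Measurable.indicator (by fun_prop) measurableSet_Iic

lemma cutoffRpow_nonneg (c : ℝ) {t : ℝ} (ht : 0 ≤ t) : 0 ≤ cutoffRpow c t :=
  Set.indicator_apply_nonneg fun _ => Real.rpow_nonneg ht c

lemma cutoffRpow_of_le {c t : ℝ} (ht : t ≤ 1) : cutoffRpow c t = t ^ c :=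
  Set.indicator_of_mem (show t ∈ Set.Iic 1 from ht) _

lemma cutoffRpow_of_lt {c t : ℝ} (ht : 1 < t) : cutoffRpow c t = 0 :=
  Set.indicator_of_notMem (show t ∉ Set.Iic 1 from ht.not_ge) _

lemma ofReal_cutoffRpow (c t : ℝ) : ENNReal.ofReal (cutoffRpow c t) =
    (Set.Iic 1).indicator (fun t : ℝ => ENNReal.ofReal (t ^ c)) t := by
  unfold cutoffRpow
  by_cases h : t ∈ Set.Iic 1
  · rw [Set.indicator_of_mem h, Set.indicator_of_mem h]
  · rw [Set.indicator_of_notMem h, Set.indicator_of_notMem h, ENNReal.ofReal_zero]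

/-- A Dirichlet-type integral over the region `{(p₁x₁)^ρ + (p₂x₂)^ρ ≤ 1}` of the quadrant. -/
lemma setLIntegral_orthant_dirichlet {p₁ p₂ ρ α₁ α₂ c d e : ℝ} (hp₁ : 0 < p₁) (hp₂ : 0 < p₂)
    (hρ : 0 < ρ) (h₁ : 0 < α₁ / ρ + d) (h₂ : 0 < α₂ / ρ + e)
    (hs : 0 < (α₁ / ρ + d) + (α₂ / ρ + e) + c) :
    ∫⁻ x in orthant 2, ENNReal.ofReal ((x 0) ^ (α₁ - 1)) * (ENNReal.ofReal ((x 1) ^ (α₂ - 1)) *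
        ENNReal.ofReal (((p₁ * x 0) ^ ρ) ^ d * ((p₂ * x 1) ^ ρ) ^ e *
          cutoffRpow c ((p₁ * x 0) ^ ρ + (p₂ * x 1) ^ ρ))) =
      ENNReal.ofReal (p₁ ^ (-α₁) / ρ * (p₂ ^ (-α₂) / ρ) *
        (ProbabilityTheory.beta (α₁ / ρ + d) (α₂ / ρ + e) /
          ((α₁ / ρ + d) + (α₂ / ρ + e) + c))) := by
  rw [setLIntegral_orthant_rpow_mul_comp hp₁ hp₂ hρ α₁ α₂
    (G := fun y z => ENNReal.ofReal (y ^ d * z ^ e * cutoffRpow c (y + z)))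
    (ENNReal.measurable_ofReal.comp (Measurable.mul (by fun_prop)
      ((measurable_cutoffRpow c).comp (by fun_prop)))), mul_assoc,
    ENNReal.ofReal_mul (by positivity), ENNReal.ofReal_mul (by positivity),
    ← lintegral_triangle_rpow h₁ h₂ hs]
  congr 2
  refine setLIntegral_congr_fun measurableSet_Ioi fun y hy => ?_
  have hy : 0 < y := hy
  -- The extra factors y^d and z^e are absorbed into the weights and shift the Dirichlet parameters.
  rw [add_sub_right_comm, Real.rpow_add hy, ENNReal.ofReal_mul (by positivity), mul_assoc,
    ← lintegral_const_mul' (ENNReal.ofReal (y ^ d)) _ ENNReal.ofReal_ne_top]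
  congr 1
  refine setLIntegral_congr_fun measurableSet_Ioi fun z hz => ?_
  have hz : 0 < z := hz
  rw [add_sub_right_comm, Real.rpow_add hz, ← ofReal_cutoffRpow,
    ENNReal.ofReal_mul (by positivity), ENNReal.ofReal_mul (by positivity),
    ENNReal.ofReal_mul (by positivity)]
  ring

/-! ### Capacity and input demand at given prices -/

lemma constA_pos {C α₁ α₂ : ℝ} (hC : 0 < C) (h₁ : 0 < α₁) (h₂ : 0 < α₂) : 0 < constA C α₁ α₂ := by
  have := ProbabilityTheory.beta_pos h₁ h₂
  unfold constA
  positivity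

lemma constAr_pos {C α₁ α₂ r : ℝ} (hC : 0 < C) (h₁ : 0 < α₁) (h₂ : 0 < α₂) (hr : r < 0) :
    0 < constAr C α₁ α₂ r := by
  have hA := constA_pos hC h₁ h₂
  have hB := ProbabilityTheory.beta_pos h₁ h₂
  have hB' := ProbabilityTheory.beta_pos (div_pos_of_neg_of_neg (neg_neg_of_pos h₁) hr)
    (div_pos_of_neg_of_neg (neg_neg_of_pos h₂) hr)
  have : 0 < -r := by linarith
  unfold constAr
  positivity

lemma measurableSet_orthant (n : ℕ) : MeasurableSet (orthant n) := (isClosed_orthant n).measurableSet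

lemma capacityMeasure_restrict (C α₁ α₂ r : ℝ) :
    (capacityMeasure C α₁ α₂ r).restrict (orthant 2) = capacityMeasure C α₁ α₂ r := by
  rw [capacityMeasure, restrict_withDensity (measurableSet_orthant 2),
    Measure.restrict_restrict (measurableSet_orthant 2), Set.inter_self]

lemma lintegral_capacityMeasure {C α₁ α₂ r : ℝ} (hA : 0 < constAr C α₁ α₂ r)
    {g : (Fin 2 → ℝ) → ℝ≥0∞} (hg : Measurable g) :
    ∫⁻ x, g x ∂capacityMeasure C α₁ α₂ r = ENNReal.ofReal (constAr C α₁ α₂ r) *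
      ∫⁻ x in orthant 2, ENNReal.ofReal ((x 0) ^ (α₁ - 1)) *
        (ENNReal.ofReal ((x 1) ^ (α₂ - 1)) * g x) := by
  rw [capacityMeasure, lintegral_withDensity_eq_lintegral_mul _ (by fun_prop) hg,
    ← lintegral_const_mul' _ _ ENNReal.ofReal_ne_top]
  refine setLIntegral_congr_fun (measurableSet_orthant 2) fun x hx => ?_
  have h0 := hx 0
  have h1 := hx 1
  simp only [Pi.mul_apply]
  rw [ENNReal.ofReal_mul (by positivity), ENNReal.ofReal_mul (by positivity)]
  ring

lemma ae_pos_capacityMeasure (C α₁ α₂ r : ℝ) :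
    ∀ᵐ x ∂capacityMeasure C α₁ α₂ r, ∀ i, 0 < x i := by
  refine (withDensity_absolutelyContinuous _ _).ae_le ?_
  rw [← Measure.restrict_congr_set (openOrthant_ae_eq_orthant 2)]
  filter_upwards [ae_restrict_mem (MeasurableSet.univ_pi fun _ => measurableSet_Ioi)] with x hx i
  exact hx i trivial

/-- The total capacity of the technologies that are profitable at input prices `p`. -/
noncomputable def profitableCapacity (C α₁ α₂ : ℝ) (p : Fin 2 → ℝ) : ℝ :=
  C ^ (α₁ + α₂ + 1) * (α₁ ^ α₁ * α₂ ^ α₂ / (α₁ + α₂ + 1) ^ (α₁ + α₂)) *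
    (p 0 ^ (-α₁) * p 1 ^ (-α₂))

/-- This is what `constAr` is normalized for: both beta values cancel, and r survives only in a
factor that the Dirichlet denominators remove. -/
lemma profitableCapacity_eq {C α₁ α₂ r : ℝ} (h₁ : 0 < α₁) (h₂ : 0 < α₂)
    (hr : r < 0) (p : Fin 2 → ℝ) :
    constAr C α₁ α₂ r * (p 0 ^ (-α₁) / (-r) * (p 1 ^ (-α₂) / (-r)) *
      ProbabilityTheory.beta (α₁ / (-r)) (α₂ / (-r))) =
    profitableCapacity C α₁ α₂ p * ((α₁ + α₂) / (-r)) := by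
  have hB := (ProbabilityTheory.beta_pos h₁ h₂).ne'
  have hr' : 0 < -r := by linarith
  have hB' := (ProbabilityTheory.beta_pos (div_pos h₁ hr') (div_pos h₂ hr')).ne'
  have e (x : ℝ) : -x / r = x / (-r) := by rw [div_neg, neg_div]
  unfold constAr constA profitableCapacity
  rw [e, e]
  generalize ProbabilityTheory.beta (α₁ / (-r)) (α₂ / (-r)) = B' at *
  generalize ProbabilityTheory.beta α₁ α₂ = B at *
  have : r ≠ 0 := hr.ne
  field_simp

/-- The cost-minimal inputs of the profitable technologies at input prices `p`. -/
noncomputable def cesDemand (ρ : ℝ) (p x : Fin 2 → ℝ) (j : Fin 2) : ℝ :=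
  (p j)⁻¹ * ((p j * x j) ^ ρ * cutoffRpow (1 / ρ - 1) ((p 0 * x 0) ^ ρ + (p 1 * x 1) ^ ρ))

lemma measurable_cesDemand (ρ : ℝ) (p : Fin 2 → ℝ) (j : Fin 2) :
    Measurable fun x => cesDemand ρ p x j :=
  measurable_const.mul (Measurable.mul (by fun_prop)
    ((measurable_cutoffRpow _).comp (by fun_prop)))

lemma cesDemand_nonneg (ρ : ℝ) {p x : Fin 2 → ℝ} (hp : p ∈ orthant 2) (hx : x ∈ orthant 2)
    (j : Fin 2) : 0 ≤ cesDemand ρ p x j := by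
  have h (i : Fin 2) : 0 ≤ (p i * x i) ^ ρ := Real.rpow_nonneg (mul_nonneg (hp i) (hx i)) _
  exact mul_nonneg (inv_nonneg.2 (hp j)) (mul_nonneg (h j)
    (cutoffRpow_nonneg _ (add_nonneg (h 0) (h 1))))

lemma lintegral_cutoff_capacityMeasure {C α₁ α₂ r : ℝ} (hC : 0 < C) (h₁ : 0 < α₁) (h₂ : 0 < α₂)
    (hr : r < 0) {p : Fin 2 → ℝ} (hp : ∀ i, 0 < p i) :
    ∫⁻ x, ENNReal.ofReal (cutoffRpow 0 ((p 0 * x 0) ^ (-r) + (p 1 * x 1) ^ (-r)))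
      ∂capacityMeasure C α₁ α₂ r = ENNReal.ofReal (profitableCapacity C α₁ α₂ p) := by
  have hA := constAr_pos hC h₁ h₂ hr
  have hr' : 0 < -r := by linarith
  have ha := div_pos h₁ hr'
  have hb := div_pos h₂ hr'
  have hD := setLIntegral_orthant_dirichlet (hp 0) (hp 1) hr' (α₁ := α₁) (α₂ := α₂) (d := 0)
    (e := 0) (c := 0) (by linarith) (by linarith) (by linarith)
  simp only [Real.rpow_zero, one_mul, add_zero] at hD
  have hm : Measurable fun x : Fin 2 → ℝ => ENNReal.ofReal
      (cutoffRpow 0 ((p 0 * x 0) ^ (-r) + (p 1 * x 1) ^ (-r))) :=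
    ENNReal.measurable_ofReal.comp ((measurable_cutoffRpow 0).comp (by fun_prop))
  rw [lintegral_capacityMeasure hA hm, hD, ← ENNReal.ofReal_mul hA.le,
    ← mul_div_assoc, ← mul_div_assoc, profitableCapacity_eq h₁ h₂ hr, ← add_div, mul_div_assoc,
    div_self (div_pos (add_pos h₁ h₂) hr').ne', mul_one]

/-- Demand carries one extra power of its own coordinate y_j = (p_j x_j)^ρ. The recurrence of the
beta function turns it into α_j / (α₁ + α₂), and the cutoff exponent 1/ρ - 1 makes the Dirichlet
denominator (α₁ + α₂ + 1)/ρ. Expenditure on input j is thus the share α_j / (α₁ + α₂ + 1) of the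
working capacity. -/
lemma lintegral_cesDemand_capacityMeasure {C α₁ α₂ r : ℝ} (hC : 0 < C) (h₁ : 0 < α₁)
    (h₂ : 0 < α₂) (hr : r < 0) {p : Fin 2 → ℝ} (hp : ∀ i, 0 < p i) (j : Fin 2) :
    ∫⁻ x, ENNReal.ofReal (cesDemand (-r) p x j) ∂capacityMeasure C α₁ α₂ r =
      ENNReal.ofReal ((p j)⁻¹ * (profitableCapacity C α₁ α₂ p *
        (![α₁, α₂] j / (α₁ + α₂ + 1)))) := by
  have hA := constAr_pos hC h₁ h₂ hr
  have hr' : 0 < -r := by linarith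
  have ha := div_pos h₁ hr'
  have hb := div_pos h₂ hr'
  have hc : 0 < 1 / (-r) := by positivity
  have hs : α₁ + α₂ ≠ 0 := (add_pos h₁ h₂).ne'
  have hs' : α₁ + α₂ + 1 ≠ 0 := by positivity
  have hrne : r ≠ 0 := hr.ne
  have hP := profitableCapacity_eq (C := C) h₁ h₂ hr p
  simp only [cesDemand, ENNReal.ofReal_mul (inv_nonneg.2 (hp j).le)]
  rw [lintegral_const_mul' _ _ ENNReal.ofReal_ne_top]
  congr 1
  have hm : Measurable fun x : Fin 2 → ℝ => ENNReal.ofReal ((p j * x j) ^ (-r) *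
      cutoffRpow (1 / (-r) - 1) ((p 0 * x 0) ^ (-r) + (p 1 * x 1) ^ (-r))) :=
    ENNReal.measurable_ofReal.comp (Measurable.mul (by fun_prop)
      ((measurable_cutoffRpow _).comp (by fun_prop)))
  rw [lintegral_capacityMeasure hA hm]
  fin_cases j
  · have hD := setLIntegral_orthant_dirichlet (hp 0) (hp 1) hr' (α₁ := α₁) (α₂ := α₂) (d := 1)
      (e := 0) (c := 1 / (-r) - 1) (by linarith) (by linarith) (by linarith)
    simp only [Real.rpow_zero, Real.rpow_one, mul_one, add_zero, beta_add_one_left ha hb] at hD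
    refine (congrArg _ hD).trans ?_
    rw [← ENNReal.ofReal_mul hA.le]
    congr 1
    have e : α₁ / (-r) + 1 + α₂ / (-r) + (1 / (-r) - 1) = (α₁ + α₂ + 1) / (-r) := by ring
    rw [e]
    calc _ = (constAr C α₁ α₂ r * (p 0 ^ (-α₁) / (-r) * (p 1 ^ (-α₂) / (-r)) *
      ProbabilityTheory.beta (α₁ / (-r)) (α₂ / (-r)))) * ((α₁ / (-r)) / (α₁ / (-r) + α₂ / (-r)) /
        ((α₁ + α₂ + 1) / (-r))) := by ring
      _ = _ := by
        rw [hP, ← add_div]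
        simp only [Fin.zero_eta, Matrix.cons_val_zero]
        field_simp
  · have hD := setLIntegral_orthant_dirichlet (hp 0) (hp 1) hr' (α₁ := α₁) (α₂ := α₂) (d := 0)
      (e := 1) (c := 1 / (-r) - 1) (by linarith) (by linarith) (by linarith)
    simp only [Real.rpow_zero, Real.rpow_one, one_mul, add_zero, beta_add_one_right ha hb] at hD
    refine (congrArg _ hD).trans ?_
    rw [← ENNReal.ofReal_mul hA.le]
    congr 1
    have e : α₁ / (-r) + (α₂ / (-r) + 1) + (1 / (-r) - 1) = (α₁ + α₂ + 1) / (-r) := by ring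
    rw [e]
    calc _ = (constAr C α₁ α₂ r * (p 0 ^ (-α₁) / (-r) * (p 1 ^ (-α₂) / (-r)) *
      ProbabilityTheory.beta (α₁ / (-r)) (α₂ / (-r)))) * ((α₂ / (-r)) / (α₁ / (-r) + α₂ / (-r)) /
        ((α₁ + α₂ + 1) / (-r))) := by ring
      _ = _ := by
        rw [hP, ← add_div]
        simp only [Fin.mk_one, Matrix.cons_val_one, Matrix.cons_val_zero]
        field_simp

/-- The prices are the marginal products of the Cobb–Douglas function at l; the identity reduces to
M^(α₁+α₂+1) = C^(α₁+α₂+1) l₁^α₁ l₂^α₂. -/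
lemma profitableCapacity_eq_cobbDouglas {C α₁ α₂ M : ℝ} {l p : Fin 2 → ℝ} (hC : 0 < C)
    (h₁ : 0 < α₁) (h₂ : 0 < α₂) (hl : ∀ i, 0 < l i) (hM : M = cobbDouglas C α₁ α₂ l)
    (hp₀ : p 0 = α₁ * M / ((α₁ + α₂ + 1) * l 0)) (hp₁ : p 1 = α₂ * M / ((α₁ + α₂ + 1) * l 1)) :
    profitableCapacity C α₁ α₂ p = M := by
  have hl0 := hl 0
  have hl1 := hl 1
  have hs : 0 < α₁ + α₂ + 1 := by positivity
  have hM0 : 0 < M := by rw [hM, cobbDouglas]; positivity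
  have hpow : M ^ (α₁ + α₂) * M = C ^ (α₁ + α₂ + 1) * (l 0 ^ α₁ * l 1 ^ α₂) := by
    rw [← Real.rpow_add_one hM0.ne', hM, cobbDouglas, Real.mul_rpow (by positivity) (by positivity),
      Real.mul_rpow (by positivity) (by positivity), ← Real.rpow_mul hl0.le, ← Real.rpow_mul hl1.le,
      div_mul_cancel₀ _ hs.ne', div_mul_cancel₀ _ hs.ne', mul_assoc]
  have e (α x : ℝ) (hα : 0 < α) (hx : 0 < x) :
      (α * M / ((α₁ + α₂ + 1) * x)) ^ (-α) = (α₁ + α₂ + 1) ^ α * x ^ α / (α ^ α * M ^ α) := by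
    rw [Real.rpow_neg (by positivity), Real.div_rpow (by positivity) (by positivity),
      Real.mul_rpow hα.le hM0.le, Real.mul_rpow hs.le hx.le, inv_div]
  rw [profitableCapacity, hp₀, hp₁, e α₁ _ h₁ hl0, e α₂ _ h₂ hl1, Real.rpow_add hs]
  have hMe : M = C ^ (α₁ + α₂ + 1) * (l 0 ^ α₁ * l 1 ^ α₂) / (M ^ α₁ * M ^ α₂) := by
    rw [← hpow, ← Real.rpow_add hM0]
    field_simp
  conv_rhs => rw [hMe]
  have : α₁ ^ α₁ ≠ 0 := by positivity
  have : α₂ ^ α₂ ≠ 0 := by positivity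
  have : (α₁ + α₂ + 1) ^ α₁ ≠ 0 := by positivity
  have : (α₁ + α₂ + 1) ^ α₂ ≠ 0 := by positivity
  generalize (α₁ + α₂ + 1) ^ α₁ = X at *
  generalize (α₁ + α₂ + 1) ^ α₂ = Y at *
  generalize α₁ ^ α₁ = Z at *
  generalize α₂ ^ α₂ = W at *
  generalize C ^ (α₁ + α₂ + 1) = V at *
  field_simp

/-! ### Profit maximization by each technology -/

lemma IsNeoclassical.apply_zero {n : ℕ} {f : (Fin n → ℝ) → ℝ} (hf : IsNeoclassical f) :
    f 0 = 0 := by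
  have := hf.homogeneous 2 two_pos 0 fun _ => le_rfl
  rw [smul_zero] at this
  linarith

lemma cutoffRpow_zero_eq_ite (t : ℝ) : cutoffRpow 0 t = if t ≤ 1 then 1 else 0 := by
  split_ifs with h
  · rw [cutoffRpow_of_le h, Real.rpow_zero]
  · exact cutoffRpow_of_lt (not_le.1 h)

section Duality

variable {ρ : ℝ} {f : (Fin 2 → ℝ) → ℝ} {p x : Fin 2 → ℝ}

/-- With the cost-minimal inputs, exactly the profitable technologies work, at full capacity. -/
lemma unitOutput_cesDemand (hρ : 0 < ρ) (hf : IsNeoclassical f)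
    (hcost : ∀ q ∈ orthant 2, youngTransform f q = cesCost ρ q) (hp : ∀ i, 0 < p i)
    (hx : ∀ i, 0 < x i) : unitOutput f x (cesDemand ρ p x) =
      cutoffRpow 0 ((p 0 * x 0) ^ ρ + (p 1 * x 1) ^ ρ) := by
  have hpx (i : Fin 2) : 0 < p i * x i := mul_pos (hp i) (hx i)
  rw [cutoffRpow_zero_eq_ite, unitOutput]
  split_ifs with h
  · have : (fun i => cesDemand ρ p x i / x i) = cesGradient ρ fun i => p i * x i := by
      funext i
      have h1 := (hp i).ne'
      have h2 := (hx i).ne'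
      rw [cesDemand, cutoffRpow_of_le h, cesGradient, Real.rpow_sub_one (hpx i).ne']
      field_simp
    rw [this, hf.apply_cesGradient hρ hcost hpx, min_self]
  · have : (fun i => cesDemand ρ p x i / x i) = 0 := by
      funext i
      rw [cesDemand, cutoffRpow_of_lt (not_le.1 h), mul_zero, mul_zero, zero_div, Pi.zero_apply]
    rw [this, hf.apply_zero, min_eq_right zero_le_one]

/-- The expenditure on the cost-minimal inputs. -/
lemma sum_mul_cesDemand (hp : ∀ i, 0 < p i) (hx : ∀ i, 0 < x i) :
    ∑ i, p i * cesDemand ρ p x i =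
      if (p 0 * x 0) ^ ρ + (p 1 * x 1) ^ ρ ≤ 1 then cesCost ρ (fun i => p i * x i) else 0 := by
  have hpx (i : Fin 2) : 0 < (p i * x i) ^ ρ := Real.rpow_pos_of_pos (mul_pos (hp i) (hx i)) _
  have h0 := (hp 0).ne'
  have h1 := (hp 1).ne'
  have hH := (add_pos (hpx 0) (hpx 1)).ne'
  split_ifs with h
  · simp only [cesDemand, Fin.sum_univ_two, cutoffRpow_of_le h, mul_inv_cancel_left₀ h0,
      mul_inv_cancel_left₀ h1, cesCost]
    rw [← add_mul, Real.rpow_sub_one hH]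
    field_simp
  · simp only [cesDemand, cutoffRpow_of_lt (not_le.1 h), mul_zero, Finset.sum_const_zero]

/-- The cost-minimal inputs of the profitable technologies maximize the profit of each technology
at input prices `p`. -/
lemma profit_le_profit_cesDemand (hρ : 0 < ρ) (hf : IsNeoclassical f)
    (hcost : ∀ q ∈ orthant 2, youngTransform f q = cesCost ρ q) (hp : ∀ i, 0 < p i)
    (hx : ∀ i, 0 < x i) {w : Fin 2 → ℝ} (hw : w ∈ orthant 2) :
    unitOutput f x w - ∑ i, p i * w i ≤
      unitOutput f x (cesDemand ρ p x) - ∑ i, p i * cesDemand ρ p x i := by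
  have hpx : (fun i => p i * x i) ∈ orthant 2 := fun i => (mul_pos (hp i) (hx i)).le
  have hH : 0 ≤ (p 0 * x 0) ^ ρ + (p 1 * x 1) ^ ρ :=
    add_nonneg (Real.rpow_nonneg (hpx 0) _) (Real.rpow_nonneg (hpx 1) _)
  have hv : (fun i => w i / x i) ∈ orthant 2 := fun i => div_nonneg (hw i) (hx i).le
  have hY := youngTransform_mul_le f hpx hv
  have hsum : ∑ i, p i * x i * (w i / x i) = ∑ i, p i * w i :=
    Finset.sum_congr rfl fun i _ => by rw [mul_assoc, mul_div_cancel₀ _ (hx i).ne']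
  rw [hcost _ hpx, hsum] at hY
  have hcn := cesCost_nonneg ρ hpx
  have hpw : 0 ≤ ∑ i, p i * w i := sum_mul_nonneg_of_mem_orthant (fun i => (hp i).le) hw
  have hy1 : unitOutput f x w ≤ 1 := min_le_left _ _
  -- With unit cost h and output y ≤ 1, expenditure is at least h * y, so for y ≥ 0 the profit is at
  -- most (1 - h) * y ≤ max (1 - h) 0.
  have hyh : cesCost ρ (fun i => p i * x i) * unitOutput f x w ≤ ∑ i, p i * w i :=
    (mul_le_mul_of_nonneg_left (min_le_right _ _) hcn).trans hY
  rw [unitOutput_cesDemand hρ hf hcost hp hx, sum_mul_cesDemand hp hx, cutoffRpow_zero_eq_ite]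
  split_ifs with h
  · have hle : cesCost ρ (fun i => p i * x i) ≤ 1 := Real.rpow_le_one hH h (by positivity)
    nlinarith
  · have hlt : 1 < cesCost ρ (fun i => p i * x i) :=
      Real.one_lt_rpow (not_le.1 h) (by positivity)
    -- f may take negative values; then nonnegative expenditure alone bounds the profit by 0.
    rcases le_total 0 (unitOutput f x w) with h0 | h0
    · nlinarith
    · linarith

end Duality

/-! ### Optimality of the plan, and vanishing inputs -/

lemma IsAdmissible.zero {n : ℕ} {f : (Fin n → ℝ) → ℝ} (hf : IsNeoclassical f)
    (μ : Measure (Fin n → ℝ)) {l : Fin n → ℝ} (hl : l ∈ orthant n) :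
    IsAdmissible f μ l 0 ∧ totalOutput f μ 0 = 0 := by
  have h (x : Fin n → ℝ) : unitOutput f x ((0 : (Fin n → ℝ) → Fin n → ℝ) x) = 0 := by
    have : (fun i => (0 : (Fin n → ℝ) → Fin n → ℝ) x i / x i) = 0 := by
      funext i
      simp
    rw [unitOutput, this, hf.apply_zero, min_eq_right zero_le_one]
  refine ⟨⟨fun x _ j => le_rfl, fun j => ?_, fun j => ?_, ?_⟩, ?_⟩
  · simp
  · simpa using hl j
  · simp only [h]
    exact integrableOn_zero
  · simp only [totalOutput, h, integral_zero]

/-- A neoclassical function with CES unit cost has no output without one of the inputs. -/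
lemma apply_nonpos_of_coord_eq_zero {ρ : ℝ} (hρ : 0 < ρ) {f : (Fin 2 → ℝ) → ℝ}
    (hcost : ∀ q ∈ orthant 2, youngTransform f q = cesCost ρ q) {v : Fin 2 → ℝ}
    (hv : v ∈ orthant 2) {j : Fin 2} (hj : v j = 0) : f v ≤ 0 := by
  -- A price charged only for the missing input: unit cost 1, expenditure 0.
  have hm : Pi.single j (1 : ℝ) ∈ orthant 2 := fun i => by
    rw [Pi.single_apply]
    split_ifs <;> norm_num
  have h := youngTransform_mul_le f hm hv
  have hc : cesCost ρ (Pi.single j 1) = 1 := by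
    fin_cases j <;> simp [cesCost, Real.zero_rpow hρ.ne']
  rw [hcost _ hm, hc, one_mul] at h
  simpa [Pi.single_apply, hj] using h

/-- A nonnegative input use whose integral is at most 0 vanishes almost everywhere, so almost no
technology can have positive output. -/
lemma totalOutput_nonpos_of_coord_eq_zero {ρ : ℝ} (hρ : 0 < ρ) {f : (Fin 2 → ℝ) → ℝ}
    (hcost : ∀ q ∈ orthant 2, youngTransform f q = cesCost ρ q) {μ : Measure (Fin 2 → ℝ)}
    {l : Fin 2 → ℝ} {j : Fin 2} (hj : l j = 0) {u : (Fin 2 → ℝ) → Fin 2 → ℝ}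
    (hu : IsAdmissible f μ l u) : totalOutput f μ u ≤ 0 := by
  have hmem := ae_restrict_mem (μ := μ) (measurableSet_orthant 2)
  have hnn : 0 ≤ᵐ[μ.restrict (orthant 2)] fun x => u x j := by
    filter_upwards [hmem] with x hx using hu.nonneg x hx j
  have hint : ∫ x in orthant 2, u x j ∂μ = 0 :=
    le_antisymm (hj ▸ hu.resource j) (integral_nonneg_of_ae hnn)
  have hz := (integral_eq_zero_iff_of_nonneg_ae hnn (hu.integrable j)).1 hint
  refine integral_nonpos_of_ae ?_
  filter_upwards [hmem, hz] with x hx hxz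
  refine (min_le_right _ _).trans (apply_nonpos_of_coord_eq_zero hρ hcost (j := j)
    (fun i => div_nonneg (hu.nonneg x hx i) (hx i)) ?_)
  rw [hxz, Pi.zero_apply, zero_div]

lemma integrable_and_integral_of_lintegral_eq {Ω : Type*} [MeasurableSpace Ω] {μ : Measure Ω}
    {g : Ω → ℝ} {c : ℝ} (hg : Measurable g) (hg₀ : 0 ≤ᵐ[μ] g) (hc : 0 ≤ c)
    (h : ∫⁻ x, ENNReal.ofReal (g x) ∂μ = ENNReal.ofReal c) :
    Integrable g μ ∧ ∫ x, g x ∂μ = c := by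
  refine ⟨(lintegral_ofReal_ne_top_iff_integrable hg.aestronglyMeasurable hg₀).1
    (h ▸ ENNReal.ofReal_ne_top), ?_⟩
  rw [integral_eq_lintegral_of_nonneg_ae hg₀ hg.aestronglyMeasurable, h, ENNReal.toReal_ofReal hc]

lemma isGreatest_totalOutput_of_pos {C α₁ α₂ r : ℝ} (hC : 0 < C) (h₁ : 0 < α₁) (h₂ : 0 < α₂)
    (hr : r < 0) {f : (Fin 2 → ℝ) → ℝ} (hf : IsNeoclassical f)
    (hcost : ∀ q ∈ orthant 2, youngTransform f q = cesCost (-r) q) {l : Fin 2 → ℝ}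
    (hl : ∀ i, 0 < l i) :
    IsGreatest {y | ∃ u, IsAdmissible f (capacityMeasure C α₁ α₂ r) l u ∧
      y = totalOutput f (capacityMeasure C α₁ α₂ r) u} (cobbDouglas C α₁ α₂ l) := by
  have hl0 := hl 0
  have hl1 := hl 1
  have hs : 0 < α₁ + α₂ + 1 := by positivity
  have hρ : 0 < -r := by linarith
  obtain ⟨M, hM⟩ : ∃ M, M = cobbDouglas C α₁ α₂ l := ⟨_, rfl⟩
  have hM0 : 0 < M := by rw [hM, cobbDouglas]; positivity
  -- The partial derivatives of the Cobb–Douglas function at l, which serve as multipliers of the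
  -- resource constraints.
  set p : Fin 2 → ℝ := fun i => ![α₁, α₂] i * M / ((α₁ + α₂ + 1) * l i) with hpdef
  have hα (i : Fin 2) : 0 < ![α₁, α₂] i := by
    fin_cases i
    · exact h₁
    · exact h₂
  have hp (i : Fin 2) : 0 < p i := div_pos (mul_pos (hα i) hM0) (mul_pos hs (hl i))
  have hV : profitableCapacity C α₁ α₂ p = M :=
    profitableCapacity_eq_cobbDouglas hC h₁ h₂ hl hM rfl rfl
  set μ := capacityMeasure C α₁ α₂ r with hμ
  have hμr : μ.restrict (orthant 2) = μ := capacityMeasure_restrict C α₁ α₂ r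
  have hpos : ∀ᵐ x ∂μ, ∀ i, 0 < x i := ae_pos_capacityMeasure C α₁ α₂ r
  have hdem (j : Fin 2) : Integrable (fun x => cesDemand (-r) p x j) μ ∧
      ∫ x, cesDemand (-r) p x j ∂μ = l j := by
    refine integrable_and_integral_of_lintegral_eq (measurable_cesDemand _ _ _) ?_ (hl j).le ?_
    · filter_upwards [hpos] with x hx
      exact cesDemand_nonneg _ (fun i => (hp i).le) (fun i => (hx i).le) j
    · rw [lintegral_cesDemand_capacityMeasure hC h₁ h₂ hr hp j, hV]
      congr 1
      have := (hα j).ne'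
      have := (hl j).ne'
      rw [hpdef]
      field_simp
  have hout : Integrable (fun x => cutoffRpow 0 ((p 0 * x 0) ^ (-r) + (p 1 * x 1) ^ (-r))) μ ∧
      ∫ x, cutoffRpow 0 ((p 0 * x 0) ^ (-r) + (p 1 * x 1) ^ (-r)) ∂μ = M := by
    refine integrable_and_integral_of_lintegral_eq ((measurable_cutoffRpow 0).comp
      (by fun_prop : Measurable fun x : Fin 2 → ℝ =>
        (p 0 * x 0) ^ (-r) + (p 1 * x 1) ^ (-r))) ?_ hM0.le ?_
    · refine Filter.Eventually.of_forall fun x => ?_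
      simp only [cutoffRpow_zero_eq_ite, Pi.zero_apply]
      split_ifs <;> norm_num
    · rw [lintegral_cutoff_capacityMeasure hC h₁ h₂ hr hp, hV]
  have hae : (fun x => unitOutput f x (cesDemand (-r) p x)) =ᵐ[μ]
      fun x => cutoffRpow 0 ((p 0 * x 0) ^ (-r) + (p 1 * x 1) ^ (-r)) := by
    filter_upwards [hpos] with x hx using unitOutput_cesDemand hρ hf hcost hp hx
  have hout' : Integrable (fun x => unitOutput f x (cesDemand (-r) p x)) μ :=
    hout.1.congr hae.symm
  have htot : ∫ x, unitOutput f x (cesDemand (-r) p x) ∂μ = M :=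
    (integral_congr_ae hae).trans hout.2
  rw [← hM]
  refine ⟨⟨cesDemand (-r) p, ⟨fun x hx => cesDemand_nonneg _ (fun i => (hp i).le) hx, fun j => ?_,
    fun j => ?_, ?_⟩, ?_⟩, ?_⟩
  · rw [IntegrableOn, hμr]
    exact (hdem j).1
  · rw [hμr, (hdem j).2]
  · rwa [IntegrableOn, hμr]
  · rw [totalOutput, hμr, htot]
  · rintro y ⟨u, hu, rfl⟩
    have hui (j : Fin 2) : Integrable (fun x => u x j) μ := by
      simpa only [IntegrableOn, hμr] using hu.integrable j
    have hur (j : Fin 2) : ∫ x, u x j ∂μ ≤ l j := by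
      simpa only [hμr] using hu.resource j
    have huo : Integrable (fun x => unitOutput f x (u x)) μ := by
      simpa only [IntegrableOn, hμr] using hu.integrable_output
    have hsum {w : (Fin 2 → ℝ) → Fin 2 → ℝ} (hw : ∀ j, Integrable (fun x => w x j) μ) :
        Integrable (fun x => ∑ i, p i * w x i) μ ∧
          ∫ x, ∑ i, p i * w x i ∂μ = ∑ i, p i * ∫ x, w x i ∂μ := by
      refine ⟨integrable_finsetSum _ fun i _ => (hw i).const_mul _, ?_⟩
      rw [integral_finsetSum _ fun i _ => (hw i).const_mul _]
      simp only [integral_const_mul]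
    have hsu := hsum hui
    have hsd := hsum fun j => (hdem j).1
    -- Weak duality: the pointwise profit inequality is integrated, and the expenditures are
    -- compared through ∫ u_j ≤ l_j, with equality for the plan.
    have hmono := integral_mono_ae (huo.sub hsu.1) (hout'.sub hsd.1) (by
      filter_upwards [hpos] with x hx
      exact profit_le_profit_cesDemand hρ hf hcost hp hx
        fun i => hu.nonneg x (fun i => (hx i).le) i)
    simp only [Pi.sub_apply] at hmono
    rw [integral_sub huo hsu.1, integral_sub hout' hsd.1, hsu.2, hsd.2, htot] at hmono
    have hb : ∑ i, p i * ∫ x, u x i ∂μ ≤ ∑ i, p i * ∫ x, cesDemand (-r) p x i ∂μ :=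
      Finset.sum_le_sum fun i _ => by
        rw [(hdem i).2]
        exact mul_le_mul_of_nonneg_left (hur i) (hp i).le
    rw [totalOutput, hμr]
    linarith

lemma isProductionFunction_cobbDouglas {C α₁ α₂ r : ℝ} (hC : 0 < C) (h₁ : 0 < α₁) (h₂ : 0 < α₂)
    (hr : r < 0) {f : (Fin 2 → ℝ) → ℝ} (hf : IsNeoclassical f) (hcost : HasCESUnitCost r f) :
    IsProductionFunction f (capacityMeasure C α₁ α₂ r) (cobbDouglas C α₁ α₂) := by
  rw [hasCESUnitCost_iff] at hcost
  intro l hl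
  by_cases hpos : ∀ i, 0 < l i
  · exact isGreatest_totalOutput_of_pos hC h₁ h₂ hr hf hcost hpos
  · push Not at hpos
    obtain ⟨j, hj⟩ := hpos
    have hj : l j = 0 := le_antisymm hj (hl j)
    have hzero : cobbDouglas C α₁ α₂ l = 0 := by
      have e₁ : α₁ / (α₁ + α₂ + 1) ≠ 0 := by positivity
      have e₂ : α₂ / (α₁ + α₂ + 1) ≠ 0 := by positivity
      fin_cases j
      · simp [cobbDouglas, show l 0 = 0 from hj, Real.zero_rpow e₁]
      · simp [cobbDouglas, show l 1 = 0 from hj, Real.zero_rpow e₂]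
    rw [hzero]
    have h0 := IsAdmissible.zero hf (capacityMeasure C α₁ α₂ r) hl
    refine ⟨⟨0, h0.1, h0.2.symm⟩, ?_⟩
    rintro y ⟨u, hu, rfl⟩
    exact totalOutput_nonpos_of_coord_eq_zero (by linarith) hcost hj hu

theorem mainTheorem10 (C α₁ α₂ r : ℝ) (hC : 0 < C) (hα₁ : 1 ≤ α₁) (hα₂ : 1 ≤ α₂)
    (hr₁ : -1 ≤ r) (hr₂ : r < 0) :
    (∃ f : (Fin 2 → ℝ) → ℝ,
      IsNeoclassical f ∧ (∀ v ∈ orthant 2, 0 ≤ f v) ∧ HasCESUnitCost r f) ∧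
    (∀ f : (Fin 2 → ℝ) → ℝ, IsNeoclassical f → HasCESUnitCost r f →
      IsProductionFunction f (capacityMeasure C α₁ α₂ r) (cobbDouglas C α₁ α₂)) :=
  ⟨exists_isNeoclassical_hasCESUnitCost hr₁ hr₂, fun _ hf hcost =>
    isProductionFunction_cobbDouglas hC (by linarith) (by linarith) hr₂ hf hcost⟩
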